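/- Let $T\ge 1$ be an integer. A $T$-periodic configuration $\mathbf X$ is the family of points $x_i+kT$ ($1\le i\le T$, $k\in\mathbb Z$), listed with multiplicity, where $0\le x_1\le\dots\le x_T<T$. Let $\mathrm d[\mathbf X]$ be the minimal distance between two distinctly labelled points of this family, and for $l\in(0,1]$ let $\mathbb X_T^{l}$ be the set of $T$-periodic configurations with $\mathrm d[\mathbf X]\ge l$. Let $u[\mathbf X]:\mathbb R\to\mathbb R$ be the $T$-periodic locally integrable function, unique up to an additive constant, whose distributional derivative is $$\mathrm Du[\mathbf X]=\mathcal L^1-\sum_{i=1}^{T}\sum_{k\in\mathbb Z}\delta_{x_i+kT}.$$ For $p\ge1$, $s\in(0,1)$ and a $T$-periodic measurable $u$ put $$\mathcal F^s_p(u)=\int_0^T\int_{\mathbb R}\frac{|u(x)-u(y)|^p}{|x-y|^{1+sp}}\,\mathrm dy\,\mathrm dx\in[0,+\infty].$$ Let $\rho\in C^\infty(\mathbb R)$ be a mollifier: $\rho\ge0$, $\int_{\mathbb R}\rho=1$, and $\rho=0$ outside $(-1,1)$. For $\varepsilon>0$ set $\rho_\varepsilon(x)=\varepsilon^{-1}\rho(x/\varepsilon)$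 and $\mathcal F^{s,\varepsilon}_p[\mathbf X]=\mathcal F^s_p(u[\mathbf X]*\rho_\varepsilon)$. Let $\mathbf X^{\mathrm{eq}}$ be the equispaced configuration, with $x_i=i-1$ for $1\le i\le T$. **Theorem.** Let $p\ge1$ and $s\in(0,1)$ with $sp\ge1$, and let $0<\varepsilon\le\frac14$. Then $\mathbf X^{\mathrm{eq}}\in\mathbb X_T^{4\varepsilon}$, and $\mathbf X^{\mathrm{eq}}$ minimises $\mathcal F^{s,\varepsilon}_p$ over $\mathbb X_T^{4\varepsilon}$. It is the unique minimiser up to translations: a configuration $\mathbf X\in\mathbb X_T^{4\varepsilon}$ minimises $\mathcal F^{s,\varepsilon}_p$ over $\mathbb X_T^{4\varepsilon}$ if and only if $\mathbf X=\mathbf X^{\mathrm{eq}}+a$ for some $a\in\mathbb R$. -/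

import Mathlib

open MeasureTheory Set
open scoped ContDiff ENNReal

/-- A `T`-periodic configuration, given by its ordered representative
`x₁ ≤ … ≤ x_T` in `[0,T)` (points may overlap). -/
structure Configuration (T : ℕ) where
  x : Fin T → ℝ
  mono : Monotone x
  mem : ∀ i, x i ∈ Ico (0 : ℝ) T

namespace Configuration

variable {T : ℕ}

/-- The points `x_i + kT` of the periodic configuration, listed with multiplicity. -/
def point (X : Configuration T) (a : Fin T × ℤ) : ℝ := X.x a.1 + a.2 * T

/-- The minimal distance `d[X]` between two distinctly labelled points of the configuration
(so it is `0` when two points overlap). -/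
noncomputable def minDist (X : Configuration T) : ℝ :=
  sInf {r : ℝ | ∃ a b : Fin T × ℤ, a ≠ b ∧ r = |X.point a - X.point b|}

/-- The class of `l`-regular configurations. -/
def regular (T : ℕ) (l : ℝ) : Set (Configuration T) := {X | l ≤ X.minDist}

/-- The equispaced configuration `ℤ`, with representative `(0, 1, …, T - 1)`. -/
def equispaced (T : ℕ) : Configuration T where
  x i := (i : ℕ)
  mono i j h := Nat.cast_le.2 (Fin.le_def.1 h)
  mem i := ⟨Nat.cast_nonneg _, by exact_mod_cast i.2⟩

/-- `X = Y + a` for some real `a`, as periodic point configurations with multiplicity. -/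
def IsTranslate (X Y : Configuration T) : Prop :=
  ∃ (a : ℝ) (e : Fin T × ℤ ≃ Fin T × ℤ), ∀ b, X.point (e b) = Y.point b + a

/-- `u` is a `T`-periodic locally integrable function whose distributional derivative is
`Du = 𝓛¹ - ∑_{i,k} δ_{x_i + kT}`. -/
structure IsDisplacement (X : Configuration T) (u : ℝ → ℝ) : Prop where
  locallyIntegrable : LocallyIntegrable u
  periodic : ∀ᵐ x : ℝ, u (x + T) = u x
  weakDeriv : ∀ φ : ℝ → ℝ, ContDiff ℝ ∞ φ → HasCompactSupport φ →
    -∫ x, u x * deriv φ x = (∫ x, φ x) - ∑ i, ∑' k : ℤ, φ (X.point (i, k))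

theorem integral_floor_mul_deriv {c τ : ℝ} (hτ : 0 < τ) {φ : ℝ → ℝ} (hφ : ContDiff ℝ ∞ φ)
    (hc : HasCompactSupport φ) :
    ∫ x, (⌊(x - c) / τ⌋ : ℝ) * deriv φ x = -∑' k : ℤ, φ (c + k * τ) := by
  have hd : Continuous (deriv φ) := hφ.continuous_deriv (by simp)
  have hdi : Integrable (deriv φ) := hd.integrable_of_hasCompactSupport hc.deriv
  have h1 : ContDiff ℝ 1 φ := hφ.of_le (by simp)
  obtain ⟨R, hR⟩ := hc.isCompact.isBounded.exists_norm_le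
  obtain ⟨N, hN⟩ := exists_nat_gt ((R + |c|) / τ)
  rw [div_lt_iff₀ hτ] at hN
  have key : ∀ x ∈ tsupport φ, -(N : ℝ) < (x - c) / τ ∧ (x - c) / τ < N := by
    intro x hx
    have h := abs_le.1 (hR x hx)
    have h2 := abs_le.1 (le_refl |c|)
    rw [lt_div_iff₀ hτ, div_lt_iff₀ hτ]
    constructor <;> linarith
  have hsum : ∑' k : ℤ, φ (c + k * τ) = ∑ k ∈ Finset.Ioc (-(N : ℤ)) N, φ (c + k * τ) := by
    apply tsum_eq_sum
    intro k hk
    by_contra h0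
    have h := key _ (subset_tsupport _ h0)
    rw [add_sub_cancel_left, mul_div_cancel_right₀ _ hτ.ne'] at h
    apply hk
    rw [Finset.mem_Ioc]
    exact ⟨by exact_mod_cast h.1, by exact_mod_cast h.2.le⟩
  have hpt : ∀ x, (⌊(x - c) / τ⌋ : ℝ) * deriv φ x = -(N : ℝ) * deriv φ x +
      ∑ k ∈ Finset.Ioc (-(N : ℤ)) N, (Ici (c + k * τ)).indicator (deriv φ) x := by
    intro x
    by_cases hx : x ∈ tsupport φ
    · obtain ⟨ha, hb⟩ := key x hx
      have hm1 : -(N : ℤ) ≤ ⌊(x - c) / τ⌋ := Int.le_floor.2 (by push_cast; exact ha.le)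
      have hm2 : ⌊(x - c) / τ⌋ < (N : ℤ) := Int.floor_lt.2 (by exact_mod_cast hb)
      have hi : ∀ k : ℤ, (Ici (c + k * τ)).indicator (deriv φ) x =
          if k ≤ ⌊(x - c) / τ⌋ then deriv φ x else 0 := by
        intro k
        have : x ∈ Ici (c + k * τ) ↔ k ≤ ⌊(x - c) / τ⌋ := by
          rw [Int.le_floor, le_div_iff₀ hτ, mem_Ici]
          constructor <;> intro h <;> linarith
        simp only [indicator_apply, this]
      simp only [hi]
      rw [← Finset.sum_filter, Finset.sum_const]
      have hf : (Finset.Ioc (-(N : ℤ)) N).filter (fun k => k ≤ ⌊(x - c) / τ⌋) =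
          Finset.Ioc (-(N : ℤ)) ⌊(x - c) / τ⌋ := by
        ext k
        simp only [Finset.mem_filter, Finset.mem_Ioc]
        omega
      rw [hf, Int.card_Ioc, nsmul_eq_mul]
      have : (((⌊(x - c) / τ⌋ - -(N : ℤ)).toNat : ℕ) : ℝ) = (⌊(x - c) / τ⌋ : ℝ) + N := by
        have : (((⌊(x - c) / τ⌋ - -(N : ℤ)).toNat : ℕ) : ℤ) = ⌊(x - c) / τ⌋ + N := by omega
        exact_mod_cast this
      rw [this]
      ring
    · have h0 : deriv φ x = 0 := by
        by_contra h
        exact hx (support_deriv_subset h)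
      simp [indicator_apply, h0]
  simp only [hpt]
  rw [integral_add (hdi.const_mul _) (integrable_finsetSum _ fun k _ =>
      hdi.indicator measurableSet_Ici), integral_const_mul,
    integral_finsetSum _ fun k _ => hdi.indicator measurableSet_Ici, hsum,
    ← Finset.sum_neg_distrib,
    integral_eq_zero_of_hasDerivAt_of_integrable
      (fun x => (h1.differentiable (by simp) x).hasDerivAt) hdi
      (h1.continuous.integrable_of_hasCompactSupport hc), mul_zero, zero_add]
  refine Finset.sum_congr rfl fun k _ => ?_
  rw [integral_indicator measurableSet_Ici, integral_Ici_eq_integral_Ioi,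
    hc.integral_Ioi_deriv_eq h1]

/-- Displacements exist: `x ↦ x - ∑ i, ⌊(x - x_i) / T⌋` is one. -/
theorem exists_isDisplacement (X : Configuration T) : ∃ u, X.IsDisplacement u := by
  have hT : ∀ _ : Fin T, (0 : ℝ) < T := fun i => by exact_mod_cast i.pos
  have hmono : ∀ i : Fin T, Monotone fun x : ℝ => (⌊(x - X.x i) / T⌋ : ℝ) := by
    intro i x y hxy
    have h := hT i
    have : ⌊(x - X.x i) / T⌋ ≤ ⌊(y - X.x i) / T⌋ := by gcongr
    exact Int.cast_le.2 this
  have hli : ∀ i : Fin T, LocallyIntegrable fun x : ℝ => (⌊(x - X.x i) / T⌋ : ℝ) :=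
    fun i => (hmono i).locallyIntegrable
  refine ⟨fun x => x - ∑ i, (⌊(x - X.x i) / T⌋ : ℝ), ?_, ?_, ?_⟩
  · exact continuous_id.locallyIntegrable.sub (locallyIntegrable_finsetSum _ fun i _ => hli i)
  · refine Filter.Eventually.of_forall fun x => ?_
    have : ∀ i : Fin T, (⌊(x + T - X.x i) / T⌋ : ℝ) = (⌊(x - X.x i) / T⌋ : ℝ) + 1 := by
      intro i
      have : (x + T - X.x i) / T = (x - X.x i) / T + 1 := by
        have := (hT i).ne'
        field_simp
        ring
      rw [this, Int.floor_add_one]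
      push_cast
      ring
    simp only [this, Finset.sum_add_distrib, Finset.sum_const, Finset.card_univ,
      Fintype.card_fin, nsmul_eq_mul]
    ring
  · intro φ hφ hc
    have hd : Continuous (deriv φ) := hφ.continuous_deriv (by simp)
    have h1 : ContDiff ℝ 1 φ := hφ.of_le (by simp)
    have hint : ∀ i : Fin T, Integrable fun x => (⌊(x - X.x i) / T⌋ : ℝ) * deriv φ x := by
      intro i
      simpa [mul_comm] using
        (hli i).integrable_smul_left_of_hasCompactSupport hd hc.deriv
    have hx : Integrable fun x : ℝ => x * deriv φ x :=
      (continuous_id.mul hd).integrable_of_hasCompactSupport hc.deriv.mul_left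
    have hφi : Integrable φ := h1.continuous.integrable_of_hasCompactSupport hc
    have hibp : ∫ x : ℝ, x * deriv φ x = -∫ x, φ x := by
      have := integral_mul_deriv_eq_deriv_mul_of_integrable (u := fun x : ℝ => x)
        (u' := fun _ => 1) (v := φ) (v' := deriv φ) (fun x _ => hasDerivAt_id x)
        (fun x _ => (h1.differentiable (by simp) x).hasDerivAt) hx
        (by simpa [Pi.mul_def] using hφi)
        ((continuous_id.mul h1.continuous).integrable_of_hasCompactSupport hc.mul_left)
      simpa using this
    simp only [sub_mul, Finset.sum_mul]
    rw [integral_sub hx (integrable_finsetSum _ fun i _ => hint i),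
      integral_finsetSum _ fun i _ => hint i, hibp,
      Finset.sum_congr rfl fun i _ => integral_floor_mul_deriv (hT i) hφ hc]
    simp only [Finset.sum_neg_distrib, point]
    ring

/-- The function `u[X]`. It is determined by `X` up to an additive constant (and null sets),
on which the energies below do not depend. -/
noncomputable def displacement (X : Configuration T) : ℝ → ℝ :=
  Classical.choose X.exists_isDisplacement

end Configuration

/-- The periodic Gagliardo energy
`𝓕ˢₚ(u) = ∫_{[0,T]} ∫_ℝ |u(x) - u(y)|ᵖ / |x - y|^{1 + sp} dy dx ∈ [0, ∞]`. -/
noncomputable def gagliardoEnergy (T : ℕ) (s p : ℝ) (u : ℝ → ℝ) : ℝ≥0∞ :=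
  ∫⁻ x in Icc (0 : ℝ) T, ∫⁻ y : ℝ, ENNReal.ofReal (|u x - u y| ^ p / |x - y| ^ (1 + s * p))

/-- A smooth mollifier supported in `(-1,1)`; symmetry is not required. -/
structure IsMollifier (ρ : ℝ → ℝ) : Prop where
  contDiff : ContDiff ℝ ∞ ρ
  nonneg : ∀ x, 0 ≤ ρ x
  support_subset : Function.support ρ ⊆ Ioo (-1) 1
  integral_eq_one : ∫ x, ρ x = 1

/-- `u ∗ ρ_ε`, where `ρ_ε(x) = ε⁻¹ ρ(x / ε)`. -/
noncomputable def mollify (ρ : ℝ → ℝ) (ε : ℝ) (u : ℝ → ℝ) : ℝ → ℝ :=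
  convolution u (fun x => ε⁻¹ * ρ (x / ε)) (ContinuousLinearMap.mul ℝ ℝ) volume

/-- The mollified energy `𝓕^{s,ε}_p[X] = 𝓕ˢₚ(u[X] ∗ ρ_ε)`. -/
noncomputable def Configuration.mollifiedEnergy {T : ℕ} (s p : ℝ) (ρ : ℝ → ℝ) (ε : ℝ)
    (X : Configuration T) : ℝ≥0∞ :=
  gagliardoEnergy T s p (mollify ρ ε X.displacement)

/-! Substituting `y = x + h` and applying Tonelli, the energy is the integral over `h` of
`incrementEnergy` against the weight `|h| ^ (-(1 + s * p))`, so it suffices to compare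
configurations at each fixed `h`.

Let `z` list the points in increasing order and let `G` be the smoothed Heaviside step. For every
integer `n`, `v (x + h) - v x = θ - ∑ⱼ bⱼ` with `θ = h - n` and `bⱼ = G (x + h - z_{j+n}) - G (x -
z_j)`. The gap condition gives all `bⱼ` the same sign at a given `x`. The convex function `ψ t = |θ
- t| ^ p - |θ| ^ p` vanishes at `0`, hence is superadditive on such families: `∑ ψ bⱼ ≤ ψ (∑ bⱼ)`.
Integrating over a period and unfolding turns the left side into `∑ᵢ shiftCost ψ G (h - (z_{i+n} -
z_i))`. Since `shiftCost` is convex and the `n`-step gaps always average to `n`, Jensen gives a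
lower bound independent of the configuration (`mul_le_incrementEnergy`). For the lattice and `n =
round h`, at most one `bⱼ` is nonzero and all shifts coincide, so the bound is attained
(`incrementEnergy_eq_of_intCast`).

For uniqueness, the minimal energy is finite, so a minimiser has the lattice's `incrementEnergy` for
almost every `h`, hence for every `h` by continuity. At `h = n = 1` the lattice value is `0`, which
forces every consecutive gap to be `1`. -/

/-! ### Smoothed Heaviside steps -/

/-- `G` is a primitive of the continuous density `r ≥ 0` carried by `[-ε, ε]`, rising from `0`
to `1`. -/
structure SmoothStep (ε : ℝ) (r G : ℝ → ℝ) : Prop where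
  cont : Continuous r
  nonneg : ∀ x, 0 ≤ r x
  zero_off : ∀ x, ε ≤ |x| → r x = 0
  hasDeriv : ∀ x, HasDerivAt G (r x) x
  eq_zero : ∀ x, x ≤ -ε → G x = 0
  eq_one : ∀ x, ε ≤ x → G x = 1

namespace SmoothStep

variable {ε : ℝ} {r G : ℝ → ℝ}

theorem continuous (h : SmoothStep ε r G) : Continuous G :=
  continuous_iff_continuousAt.2 fun x => (h.hasDeriv x).continuousAt

theorem hasCompactSupport (h : SmoothStep ε r G) : HasCompactSupport r := by
  refine HasCompactSupport.of_support_subset_isCompact (isCompact_Icc (a := -ε) (b := ε)) ?_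
  intro x hx
  by_contra hn
  refine hx (h.zero_off x ?_)
  by_contra hlt
  exact hn (abs_le.1 (not_le.1 hlt).le)

theorem monotone (h : SmoothStep ε r G) : Monotone G :=
  monotone_of_hasDerivAt_nonneg h.hasDeriv h.nonneg

theorem apply_nonneg (h : SmoothStep ε r G) (x : ℝ) : 0 ≤ G x := by
  rw [← h.eq_zero (min x (-ε)) (min_le_right _ _)]
  exact h.monotone (min_le_left _ _)

theorem apply_le_one (h : SmoothStep ε r G) (x : ℝ) : G x ≤ 1 := by
  rw [← h.eq_one (max x ε) (le_max_right _ _)]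
  exact h.monotone (le_max_left _ _)

theorem shift_sub_eq_zero (h : SmoothStep ε r G) {x τ : ℝ} (hx : ε + |τ| ≤ |x|) :
    G (x + τ) - G x = 0 := by
  have h1 := neg_abs_le τ
  have h2 := le_abs_self τ
  have h3 := abs_nonneg τ
  rcases le_abs.1 hx with hx | hx
  · rw [h.eq_one _ (by linarith), h.eq_one _ (by linarith), sub_self]
  · rw [h.eq_zero _ (by linarith), h.eq_zero _ (by linarith), sub_self]

/-- A step has no nonzero period. -/
theorem eq_zero_of_shift_eq (h : SmoothStep ε r G) {τ : ℝ} (hτ : ∀ x, G (x + τ) = G x) :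
    τ = 0 := by
  by_contra h0
  have hk : ∀ k : ℕ, ∀ x, G (x + k * τ) = G x := by
    intro k
    induction k with
    | zero => simp
    | succ k ih =>
      intro x
      rw [← ih x, ← hτ (x + k * τ)]
      push_cast
      ring_nf
  -- After `k` periods the shift exceeds `2 * |ε|`, so it joins the plateau `0` to the plateau `1`.
  obtain ⟨k, hk'⟩ := exists_nat_gt (2 * |ε| / |τ|)
  rw [div_lt_iff₀ (abs_pos.2 h0)] at hk'
  have h3 := neg_abs_le ε
  have h4 := le_abs_self ε
  rcases lt_or_gt_of_ne h0 with hneg | hpos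
  · rw [abs_of_neg hneg] at hk'
    have := hk k |ε|
    rw [h.eq_one |ε| h4, h.eq_zero _ (by linarith)] at this
    exact zero_ne_one this
  · rw [abs_of_pos hpos] at hk'
    have := hk k (-|ε|)
    rw [h.eq_zero (-|ε|) (by linarith), h.eq_one _ (by linarith)] at this
    exact one_ne_zero this

end SmoothStep

/-! ### Convexity of the cost of shifting a step -/

/-- The cost `∫ ψ (G (x + τ) - G x) dx` of shifting the step `G` by `τ`. -/
noncomputable def shiftCost (ψ G : ℝ → ℝ) (τ : ℝ) : ℝ := ∫ x, ψ (G (x + τ) - G x)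

section shiftCost

variable {ε : ℝ} {r G ψ : ℝ → ℝ}

theorem SmoothStep.support_shift_subset (h : SmoothStep ε r G) (h0 : ψ 0 = 0) (τ : ℝ) :
    Function.support (fun x => ψ (G (x + τ) - G x)) ⊆ Icc (-(ε + |τ|)) (ε + |τ|) := by
  intro x hx
  by_contra hn
  apply hx
  simp only
  rw [h.shift_sub_eq_zero, h0]
  by_contra hlt
  exact hn (abs_le.1 (not_le.1 hlt).le)

theorem SmoothStep.hasCompactSupport_shift (h : SmoothStep ε r G) (h0 : ψ 0 = 0) (τ : ℝ) :
    HasCompactSupport (fun x => ψ (G (x + τ) - G x)) :=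
  HasCompactSupport.of_support_subset_isCompact isCompact_Icc (h.support_shift_subset h0 τ)

theorem SmoothStep.integrable_shift (h : SmoothStep ε r G) (hψ : Continuous ψ) (h0 : ψ 0 = 0)
    (τ : ℝ) : Integrable (fun x => ψ (G (x + τ) - G x)) := by
  have := h.continuous
  exact Continuous.integrable_of_hasCompactSupport (by fun_prop) (h.hasCompactSupport_shift h0 τ)

/-- Differentiation under the integral, followed by a translation by `τ`. In the translated form the
weight `r x` no longer depends on `τ`, which makes monotonicity in `τ` visible. -/
theorem SmoothStep.hasDerivAt_shiftCost (h : SmoothStep ε r G) (hψ : ContDiff ℝ 1 ψ)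
    (h0 : ψ 0 = 0) (τ : ℝ) :
    HasDerivAt (shiftCost ψ G) (∫ x, deriv ψ (G x - G (x - τ)) * r x) τ := by
  have hG := h.continuous
  have hr := h.cont
  have hψc := hψ.continuous
  have hd : Continuous (deriv ψ) := hψ.continuous_deriv (by simp)
  obtain ⟨C, hC⟩ := (isCompact_Icc (a := (-1 : ℝ)) (b := 1)).exists_bound_of_continuousOn
    hd.continuousOn
  have hrc := h.hasCompactSupport
  obtain ⟨M, hM⟩ := hr.bounded_above_of_compact_support hrc
  have hC0 : 0 ≤ C := (norm_nonneg _).trans (hC 0 (by simp))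
  have hM0 : 0 ≤ M := (norm_nonneg _).trans (hM 0)
  -- For `t` within `1` of `τ`, the density `r (x + t)` vanishes outside `[-L, L]`; `C` bounds
  -- `deriv ψ` on `[-1, 1]`, where the differences of `G` lie.
  set L := ε + |τ| + 1 with hL
  have key := hasDerivAt_integral_of_dominated_loc_of_deriv_le (μ := volume) (x₀ := τ)
    (s := Metric.ball τ 1) (F := fun t x => ψ (G (x + t) - G x))
    (F' := fun t x => deriv ψ (G (x + t) - G x) * r (x + t))
    (bound := (Icc (-L) L).indicator fun _ => C * M)
    (Metric.ball_mem_nhds _ one_pos)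
    (Filter.Eventually.of_forall fun t => by
      exact Continuous.aestronglyMeasurable (by fun_prop))
    (h.integrable_shift hψc h0 τ)
    (Continuous.aestronglyMeasurable (by fun_prop))
    (Filter.Eventually.of_forall fun x t ht => by
      rw [Metric.mem_ball, Real.dist_eq] at ht
      by_cases hx : x ∈ Icc (-L) L
      · rw [indicator_of_mem hx, norm_mul]
        refine mul_le_mul (hC _ ?_) (hM _) (norm_nonneg _) hC0
        have a1 := h.apply_nonneg x
        have a2 := h.apply_le_one x
        have a3 := h.apply_nonneg (x + t)
        have a4 := h.apply_le_one (x + t)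
        constructor <;> linarith
      · rw [indicator_of_notMem hx, h.zero_off (x + t), mul_zero, norm_zero]
        by_contra hlt
        apply hx
        have b1 := abs_lt.1 (not_le.1 hlt)
        have b2 := abs_lt.1 ht
        have b3 := neg_abs_le τ
        have b4 := le_abs_self τ
        constructor <;> linarith)
    ((integrable_indicator_iff measurableSet_Icc).2 (by
      exact integrableOn_const (by simp)))
    (Filter.Eventually.of_forall fun x t _ => by
      have e1 : HasDerivAt (fun t => G (x + t) - G x) (r (x + t)) t := by
        have := ((h.hasDeriv (x + t)).comp_const_add x t).sub_const (G x)
        exact this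
      have e2 := ((hψ.differentiable (by simp)) (G (x + t) - G x)).hasDerivAt
      exact HasDerivAt.comp t e2 e1)
  have e : ∫ x, deriv ψ (G x - G (x - τ)) * r x =
      ∫ x, deriv ψ (G (x + τ) - G x) * r (x + τ) := by
    rw [← integral_add_right_eq_self (fun x => deriv ψ (G x - G (x - τ)) * r x) τ]
    simp
  rw [e]
  exact key.2

/-- The derivative is nondecreasing: `G x - G (x - τ)` grows with `τ`, `deriv ψ` is monotone, and
`r` is nonnegative. -/
theorem SmoothStep.convexOn_shiftCost (h : SmoothStep ε r G) (hψ : ContDiff ℝ 1 ψ)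
    (hconv : ConvexOn ℝ univ ψ) (h0 : ψ 0 = 0) : ConvexOn ℝ univ (shiftCost ψ G) := by
  have hG := h.continuous
  have hr := h.cont
  have hd : Continuous (deriv ψ) := hψ.continuous_deriv (by simp)
  have hrc := h.hasCompactSupport
  refine Monotone.convexOn_univ_of_deriv
    (fun τ => (h.hasDerivAt_shiftCost hψ h0 τ).differentiableAt) ?_
  intro τ σ hτσ
  rw [(h.hasDerivAt_shiftCost hψ h0 τ).deriv, (h.hasDerivAt_shiftCost hψ h0 σ).deriv]
  have hint : ∀ t, Integrable fun x => deriv ψ (G x - G (x - t)) * r x := fun t =>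
    Continuous.integrable_of_hasCompactSupport (by fun_prop) hrc.mul_left
  refine integral_mono (hint τ) (hint σ) fun x => ?_
  refine mul_le_mul_of_nonneg_right ?_ (h.nonneg x)
  refine (hconv.monotoneOn_deriv fun x _ => (hψ.differentiable (by simp)) x) (mem_univ _)
    (mem_univ _) ?_
  have := h.monotone (show x - σ ≤ x - τ by linarith)
  linarith

end shiftCost

/-! ### Superadditivity of convex functions vanishing at zero -/

section superadditive

variable {ψ : ℝ → ℝ}

/-- Both `a` and `b` are convex combinations of `a + b` and `0`, with weights on `a + b` that sum to
`1`. -/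
theorem ConvexOn.add_le_of_nonneg (hconv : ConvexOn ℝ univ ψ) (h0 : ψ 0 = 0) {a b : ℝ}
    (ha : 0 ≤ a) (hb : 0 ≤ b) : ψ a + ψ b ≤ ψ (a + b) := by
  rcases (add_nonneg ha hb).eq_or_lt' with h | h
  · have : a = 0 := by linarith
    have : b = 0 := by linarith
    simp [*]
  · have h1 := hconv.2 (mem_univ (a + b)) (mem_univ 0) (div_nonneg ha h.le) (div_nonneg hb h.le)
      (by field_simp)
    have h2 := hconv.2 (mem_univ (a + b)) (mem_univ 0) (div_nonneg hb h.le) (div_nonneg ha h.le)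
      (by field_simp; ring)
    simp only [smul_eq_mul, mul_zero, add_zero, h0] at h1 h2
    rw [div_mul_cancel₀ _ h.ne'] at h1 h2
    have : a / (a + b) * ψ (a + b) + b / (a + b) * ψ (a + b) = ψ (a + b) := by
      field_simp
    linarith

theorem ConvexOn.sum_le_of_nonneg (hconv : ConvexOn ℝ univ ψ) (h0 : ψ 0 = 0) {ι : Type*}
    (s : Finset ι) {b : ι → ℝ} (hb : ∀ i, 0 ≤ b i) : ∑ i ∈ s, ψ (b i) ≤ ψ (∑ i ∈ s, b i) := by
  classical
  induction s using Finset.induction_on with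
  | empty => simp [h0]
  | insert i s hi ih =>
    rw [Finset.sum_insert hi, Finset.sum_insert hi]
    have := hconv.add_le_of_nonneg h0 (hb i) (Finset.sum_nonneg (s := s) fun j _ => hb j)
    linarith

theorem ConvexOn.sum_le_of_same_sign (hconv : ConvexOn ℝ univ ψ) (h0 : ψ 0 = 0) {ι : Type*}
    (s : Finset ι) {b : ι → ℝ} (hb : (∀ i, 0 ≤ b i) ∨ ∀ i, b i ≤ 0) :
    ∑ i ∈ s, ψ (b i) ≤ ψ (∑ i ∈ s, b i) := by
  rcases hb with hb | hb
  · exact hconv.sum_le_of_nonneg h0 s hb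
  · have hc : ConvexOn ℝ univ fun t => ψ (-t) := by
      refine ⟨convex_univ, fun x _ y _ a b ha hb hab => ?_⟩
      have := hconv.2 (mem_univ (-x)) (mem_univ (-y)) ha hb hab
      simp only [smul_eq_mul] at this ⊢
      convert this using 2
      ring
    have := hc.sum_le_of_nonneg (by simpa using h0) s (b := fun i => -b i)
      (fun i => neg_nonneg.2 (hb i))
    simpa using this

end superadditive

/-! ### The power cost -/

/-- The normalised power cost `|θ - t| ^ p - |θ| ^ p`. -/
noncomputable def powerCost (p θ t : ℝ) : ℝ := |θ - t| ^ p - |θ| ^ p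

theorem powerCost_zero (p θ : ℝ) : powerCost p θ 0 = 0 := by simp [powerCost]

theorem contDiff_powerCost {p : ℝ} (hp : 1 < p) (θ : ℝ) : ContDiff ℝ 1 (powerCost p θ) := by
  have h := (contDiff_norm_rpow (E := ℝ) hp).comp
    ((contDiff_const (c := θ)).sub (contDiff_id (𝕜 := ℝ) (E := ℝ)))
  exact h.sub contDiff_const

theorem convexOn_powerCost {p : ℝ} (hp : 1 ≤ p) (θ : ℝ) : ConvexOn ℝ univ (powerCost p θ) := by
  refine ⟨convex_univ, fun x _ y _ a b ha hb hab => ?_⟩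
  have h1 : |θ - (a • x + b • y)| ≤ a * |θ - x| + b * |θ - y| := by
    have : θ - (a • x + b • y) = a * (θ - x) + b * (θ - y) := by
      simp only [smul_eq_mul]
      linear_combination (-θ) * hab
    rw [this]
    refine (abs_add_le _ _).trans ?_
    rw [abs_mul, abs_mul, abs_of_nonneg ha, abs_of_nonneg hb]
  have h2 := Real.rpow_le_rpow (abs_nonneg _) h1 (by linarith : 0 ≤ p)
  have h3 := (convexOn_rpow hp).2 (abs_nonneg (θ - x)) (abs_nonneg (θ - y)) ha hb hab
  simp only [smul_eq_mul, powerCost] at h1 h2 h3 ⊢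
  have h4 : a * |θ| ^ p + b * |θ| ^ p = |θ| ^ p := by rw [← add_mul, hab, one_mul]
  linarith

theorem Int.apply_eq_add_mul_of_step {w : ℤ → ℝ} {c : ℝ} (h : ∀ n, w (n + 1) = w n + c)
    (n : ℤ) : w n = w 0 + n * c := by
  induction n using Int.induction_on with
  | zero => simp
  | succ n ih => rw [h, ih]; push_cast; ring
  | pred n ih =>
    have := h (-(n : ℤ) - 1)
    rw [sub_add_cancel, ih] at this
    push_cast at this ⊢
    linarith

/-! ### Periodic sequences and the ordered enumeration of a configuration -/

/-- A sequence `z : ℤ → ℝ` with `z (j + T) = z j + T` and gaps at least `l`. -/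
structure PeriodicSeq (T : ℕ) (l : ℝ) (z : ℤ → ℝ) : Prop where
  add_period : ∀ j, z (j + T) = z j + T
  gap : ∀ j k, j < k → z j + l ≤ z k
  dist_le : ∀ j : ℤ, |z j - j| ≤ T

namespace PeriodicSeq

variable {T : ℕ} {l : ℝ} {z : ℤ → ℝ}

theorem add_mul_period (h : PeriodicSeq T l z) (j k : ℤ) : z (j + k * T) = z j + k * T := by
  have := Int.apply_eq_add_mul_of_step (w := fun k => z (j + k * T)) (c := T) (fun n => by
    rw [← h.add_period]
    congr 1
    ring) k
  simpa using this

/-- Raising `n` by one adds a telescoping sum over a full period, equal to `T`. Thus the mean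
`n`-step gap is `n` for every configuration, which is what Jensen needs. -/
theorem sum_shift_sub (h : PeriodicSeq T l z) (n : ℤ) :
    ∑ i ∈ Finset.range T, (z (i + n) - z i) = n * T := by
  have := Int.apply_eq_add_mul_of_step
    (w := fun n => ∑ i ∈ Finset.range T, (z (i + n) - z i)) (c := T) (fun n => by
      rw [← sub_eq_iff_eq_add', ← Finset.sum_sub_distrib]
      have h1 := Finset.sum_range_sub (fun i : ℕ => z (i + n)) T
      have h2 := h.add_period n
      rw [add_comm] at h2
      simp only [Nat.cast_zero, zero_add, h2, add_sub_cancel_left] at h1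
      rw [← h1]
      refine Finset.sum_congr rfl fun i _ => ?_
      push_cast
      rw [show (i : ℤ) + (n + 1) = i + 1 + n by ring]
      ring) n
  simpa using this

end PeriodicSeq

theorem periodicSeq_intCast (T : ℕ) : PeriodicSeq T 1 (fun j => (j : ℝ)) where
  add_period j := by push_cast; ring
  gap j k h := by exact_mod_cast h
  dist_le j := by simp

/-- Labels `(i, k)` in the order of the integers `k T + i`. -/
def labelEquiv (T : ℕ) [NeZero T] : ℤ ≃ Fin T × ℤ :=
  (Int.divModEquiv T).trans (Equiv.prodComm _ _)

theorem labelEquiv_symm_apply {T : ℕ} [NeZero T] (b : Fin T × ℤ) :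
    (labelEquiv T).symm b = b.2 * T + (b.1 : ℕ) := rfl

namespace Configuration

variable {T : ℕ} [NeZero T]

/-- The points of a configuration listed in increasing order. -/
def enum (X : Configuration T) (j : ℤ) : ℝ := X.point (labelEquiv T j)

theorem enum_mul_add (X : Configuration T) (k : ℤ) (i : Fin T) :
    X.enum (k * T + (i : ℕ)) = X.x i + k * T := by
  have : labelEquiv T (k * T + (i : ℕ)) = (i, k) := by
    rw [← labelEquiv_symm_apply (i, k), Equiv.apply_symm_apply]
  rw [enum, this, point]

theorem exists_label (T : ℕ) [NeZero T] (j : ℤ) : ∃ (k : ℤ) (i : Fin T), j = k * T + (i : ℕ) :=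
  ⟨(labelEquiv T j).2, (labelEquiv T j).1, by
    rw [← labelEquiv_symm_apply, Equiv.symm_apply_apply]⟩

theorem enum_monotone (X : Configuration T) : Monotone X.enum := by
  refine monotone_int_of_le_succ fun j => ?_
  obtain ⟨k, i, rfl⟩ := exists_label T j
  by_cases hi : (i : ℕ) + 1 < T
  · have := X.enum_mul_add k ⟨i + 1, hi⟩
    push_cast at this
    rw [← add_assoc] at this
    rw [this, enum_mul_add]
    have : X.x i ≤ X.x ⟨i + 1, hi⟩ := X.mono (Fin.le_def.2 (by simp))
    linarith
  -- The last point of a period is followed by the first point of the next one: `x_i < T ≤ x_0 + T`.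
  · have h1 : (i : ℕ) + 1 = T := by omega
    have h2 : k * T + ((i : ℕ) : ℤ) + 1 = (k + 1) * T + ((0 : Fin T) : ℕ) := by
      rw [Fin.val_zero, add_assoc]
      have : ((i : ℕ) : ℤ) + 1 = T := by exact_mod_cast h1
      rw [this]
      push_cast
      ring
    rw [h2, enum_mul_add, enum_mul_add]
    have h3 := (X.mem i).2
    have h4 := (X.mem 0).1
    push_cast
    linarith

theorem le_abs_point_sub {T : ℕ} {X : Configuration T} {l : ℝ} (hX : X ∈ regular T l)
    {a b : Fin T × ℤ} (hab : a ≠ b) : l ≤ |X.point a - X.point b| :=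
  le_trans hX (csInf_le ⟨0, by rintro r ⟨a, b, -, rfl⟩; exact abs_nonneg _⟩ ⟨a, b, hab, rfl⟩)

/-- Keeping the `j`-th point within `T` of `j` lets sums over all points be cut to explicit windows
of labels. -/
theorem abs_enum_sub_le (X : Configuration T) (j : ℤ) : |X.enum j - j| ≤ T := by
  obtain ⟨k, i, rfl⟩ := exists_label T j
  rw [enum_mul_add]
  have h3 := X.mem i
  have h4 : ((i : ℕ) : ℝ) < T := by exact_mod_cast i.2
  have h5 : (0 : ℝ) ≤ (i : ℕ) := by positivity
  push_cast
  rw [abs_le]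
  constructor <;> linarith [h3.1, h3.2]

theorem periodicSeq_enum {X : Configuration T} {l : ℝ} (hX : X ∈ regular T l) :
    PeriodicSeq T l X.enum where
  add_period j := by
    obtain ⟨k, i, rfl⟩ := exists_label T j
    rw [show k * T + ((i : ℕ) : ℤ) + T = (k + 1) * T + (i : ℕ) by ring, enum_mul_add,
      enum_mul_add]
    push_cast
    ring
  gap j k hjk := by
    have h1 := X.enum_monotone hjk.le
    have h2 := le_abs_point_sub hX (a := labelEquiv T k) (b := labelEquiv T j)
      (fun h => hjk.ne' ((labelEquiv T).injective h))
    change l ≤ |X.enum k - X.enum j| at h2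
    rw [abs_of_nonneg (by linarith)] at h2
    linarith
  dist_le := X.abs_enum_sub_le

theorem enum_equispaced (j : ℤ) : (equispaced T).enum j = j := by
  obtain ⟨k, i, rfl⟩ := exists_label T j
  rw [enum_mul_add]
  simp only [equispaced]
  push_cast
  ring

theorem apply_enum_eq_zero (X : Configuration T) {f : ℝ → ℝ} {R : ℝ}
    (hf : ∀ y, R ≤ |y| → f y = 0) {N : ℕ} (hN : R + T ≤ N) {j : ℤ}
    (hj : j ∉ Finset.Ico (-(N : ℤ)) N) : f (X.enum j) = 0 := by
  apply hf
  have h1 := abs_le.1 (X.abs_enum_sub_le j)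
  rw [Finset.mem_Ico, not_and_or, not_le, not_lt] at hj
  rcases hj with hj | hj
  · have : (j : ℝ) < -N := by exact_mod_cast hj
    exact le_trans (by linarith) (neg_le_abs _)
  · have : (N : ℝ) ≤ j := by exact_mod_cast hj
    exact le_trans (by linarith) (le_abs_self _)

theorem summable_point (X : Configuration T) {f : ℝ → ℝ} {R : ℝ}
    (hf : ∀ y, R ≤ |y| → f y = 0) : Summable fun b => f (X.point b) := by
  obtain ⟨N, hN⟩ := exists_nat_ge (R + T)
  rw [← (labelEquiv T).summable_iff]
  exact summable_of_ne_finset_zero (s := Finset.Ico (-(N : ℤ)) N)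
    fun j hj => X.apply_enum_eq_zero hf hN hj

theorem sum_tsum_point (X : Configuration T) {f : ℝ → ℝ} {R : ℝ}
    (hf : ∀ y, R ≤ |y| → f y = 0) :
    ∑ i, ∑' k : ℤ, f (X.point (i, k)) = ∑' b, f (X.point b) := by
  rw [(X.summable_point hf).tsum_prod, tsum_fintype]

theorem sum_tsum_point_eq_sum_enum (X : Configuration T) {f : ℝ → ℝ} {R : ℝ}
    (hf : ∀ y, R ≤ |y| → f y = 0) {N : ℕ} (hN : R + T ≤ N) :
    ∑ i, ∑' k : ℤ, f (X.point (i, k)) = ∑ j ∈ Finset.Ico (-(N : ℤ)) N, f (X.enum j) := by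
  rw [X.sum_tsum_point hf, ← (labelEquiv T).tsum_eq]
  exact tsum_eq_sum fun j hj => X.apply_enum_eq_zero hf hN hj

theorem equispaced_mem_regular {l : ℝ} (hl : l ≤ 1) : equispaced T ∈ regular T l := by
  refine le_trans hl (le_csInf ⟨_, (0, 0), (0, 1), by simp, rfl⟩ ?_)
  rintro r ⟨a, b, hab, rfl⟩
  have h : ∀ a, (equispaced T).point a = (((labelEquiv T).symm a : ℤ) : ℝ) := fun a => by
    rw [← enum_equispaced (T := T), enum, Equiv.apply_symm_apply]
  rw [h, h]
  have : (labelEquiv T).symm a - (labelEquiv T).symm b ≠ 0 :=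
    sub_ne_zero.2 fun h => hab ((labelEquiv T).symm.injective h)
  exact_mod_cast Int.one_le_abs this

end Configuration

/-! ### Finite sums over windows of integers -/

theorem Finset.sum_range_mul_eq {M : Type*} [AddCommMonoid M] (g : ℕ → M) (m n : ℕ) :
    ∑ j ∈ Finset.range (m * n), g j =
      ∑ k ∈ Finset.range m, ∑ i ∈ Finset.range n, g (k * n + i) := by
  induction m with
  | zero => simp
  | succ m ih => rw [add_mul, one_mul, Finset.sum_range_add, ih, Finset.sum_range_succ]

theorem Finset.sum_Ico_int_block {M : Type*} [AddCommMonoid M] (g : ℤ → M) (K T : ℕ) :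
    ∑ j ∈ Finset.Ico (-((K * T : ℕ) : ℤ)) (K * T : ℕ), g j =
      ∑ k ∈ Finset.range (2 * K), ∑ i ∈ Finset.range T, g (((k : ℤ) - K) * T + i) := by
  have h1 : Finset.Ico (-((K * T : ℕ) : ℤ)) (K * T : ℕ) =
      (Finset.range (2 * K * T)).map
        ⟨fun m : ℕ => (m : ℤ) - (K * T : ℕ), fun a b h => by simpa using h⟩ := by
    ext j
    simp only [Finset.mem_Ico, Finset.mem_map, Finset.mem_range, DFunLike.coe]
    constructor
    · intro h
      refine ⟨(j + (K * T : ℕ)).toNat, ?_, ?_⟩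
      · rw [mul_assoc]; omega
      · omega
    · rintro ⟨m, hm, rfl⟩
      rw [mul_assoc] at hm
      omega
  rw [h1, Finset.sum_map, Finset.sum_range_mul_eq]
  refine Finset.sum_congr rfl fun k _ => Finset.sum_congr rfl fun i _ => ?_
  congr 1
  simp only [DFunLike.coe]
  push_cast
  ring

theorem Finset.sum_Ico_int_of_step {a : ℤ → ℝ} {M p q : ℤ} (hM : 0 ≤ M) (hp : p ≤ -M)
    (hq : M ≤ q) (h1 : ∀ j ≤ -M, a j = 1) (h0 : ∀ j, M ≤ j → a j = 0) :
    ∑ j ∈ Finset.Ico p q, a j = ∑ j ∈ Finset.Ico (-M) M, a j + (-M - p) := by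
  rw [← Finset.Ico_union_Ico_eq_Ico hp (by omega : -M ≤ q),
    Finset.sum_union (Finset.Ico_disjoint_Ico_consecutive _ _ _),
    ← Finset.Ico_union_Ico_eq_Ico (by omega : -M ≤ M) hq,
    Finset.sum_union (Finset.Ico_disjoint_Ico_consecutive _ _ _),
    Finset.sum_congr rfl (g := fun _ => (1 : ℝ)) fun j hj => h1 j (Finset.mem_Ico.1 hj).2.le,
    Finset.sum_eq_zero (s := Finset.Ico M q) fun j hj => h0 j (Finset.mem_Ico.1 hj).1]
  simp only [Finset.sum_const, Int.card_Ico, nsmul_eq_mul, mul_one, add_zero]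
  have : (((-M - p).toNat : ℕ) : ℤ) = -M - p := by omega
  have : (((-M - p).toNat : ℕ) : ℝ) = -M - p := by exact_mod_cast this
  rw [this]
  ring

/-- Moving the window by `n` trades `n` terms equal to `1` on the left for `n` zeros on the right
(conversely if `n < 0`). This is the source of the `n` in `h - n`. -/
theorem Finset.sum_Ico_int_shift_sub {a : ℤ → ℝ} {M N n : ℤ} (hM : 0 ≤ M) (hN : M + |n| ≤ N)
    (h1 : ∀ j ≤ -M, a j = 1) (h0 : ∀ j, M ≤ j → a j = 0) :
    ∑ j ∈ Finset.Ico (-N) N, a (j + n) = ∑ j ∈ Finset.Ico (-N) N, a j - n := by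
  have hn := abs_le.1 (le_refl |n|)
  rw [Finset.sum_Ico_add' a, Finset.sum_Ico_int_of_step hM (by omega) (by omega) h1 h0,
    Finset.sum_Ico_int_of_step hM (by omega : -N ≤ -M) (by omega) h1 h0]
  push_cast
  ring

/-- The equality case of superadditivity used for the lattice. -/
theorem apply_sum_eq_of_subsingleton_support {ψ : ℝ → ℝ} (h0 : ψ 0 = 0) {ι : Type*}
    (s : Finset ι) {b : ι → ℝ} (hb : ∀ i j, i ≠ j → b i = 0 ∨ b j = 0) :
    ψ (∑ i ∈ s, b i) = ∑ i ∈ s, ψ (b i) := by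
  by_cases h : ∃ i ∈ s, b i ≠ 0
  · obtain ⟨i, hi, hbi⟩ := h
    have hj : ∀ j ∈ s, j ≠ i → b j = 0 := fun j _ hj =>
      (hb i j hj.symm).resolve_left hbi
    rw [Finset.sum_eq_single_of_mem i hi hj,
      Finset.sum_eq_single_of_mem i hi fun j hjs hji => by rw [hj j hjs hji, h0]]
  · push Not at h
    rw [Finset.sum_eq_zero h, h0, Finset.sum_eq_zero fun i hi => by rw [h i hi, h0]]

/-! ### Pair increments and the sharp bound at fixed `h` -/

/-- The contribution `G (x + h - z_{j+n}) - G (x - z_j)` of the pair `(z_j, z_{j+n})` to the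
increment over `[x, x + h]` of the smoothed counting function. -/
def pairIncrement (G : ℝ → ℝ) (z : ℤ → ℝ) (h : ℝ) (n j : ℤ) (x : ℝ) : ℝ :=
  G (x + h - z (j + n)) - G (x - z j)

section

variable {T : ℕ} {l ε : ℝ} {r G ψ : ℝ → ℝ} {z : ℤ → ℝ}

/-- Gaps of at least `2 * ε` keep the steps from overlapping, so at any point `y` the sequence `j ↦
G (y - z j)` reads `1, …, 1, t, 0, …, 0`. Two sequences of this shape are always comparable
termwise. -/
theorem pairIncrement_same_sign (hG : SmoothStep ε r G) (hz : PeriodicSeq T l z)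
    (hl : 2 * ε ≤ l) (h : ℝ) (n : ℤ) (x : ℝ) :
    (∀ j, 0 ≤ pairIncrement G z h n j x) ∨ ∀ j, pairIncrement G z h n j x ≤ 0 := by
  have key : ∀ y j k, j < k → G (y - z j) < 1 → G (y - z k) = 0 := by
    intro y j k hjk hlt
    have h1 := hz.gap j k hjk
    have h2 : y - z j < ε := by
      by_contra hn
      exact hlt.ne (hG.eq_one _ (not_lt.1 hn))
    exact hG.eq_zero _ (by linarith)
  by_contra hcon
  push Not at hcon
  obtain ⟨⟨k, hk⟩, i, hi⟩ := hcon
  simp only [pairIncrement, sub_pos, sub_neg] at hk hi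
  rcases lt_trichotomy i k with hik | rfl | hik
  · have := key x i k hik (hi.trans_le (hG.apply_le_one _))
    have h2 := hG.apply_nonneg (x + h - z (k + n))
    linarith
  · linarith
  · have := key (x + h) (k + n) (i + n) (by omega) (hk.trans_le (hG.apply_le_one _))
    have h2 := hG.apply_nonneg (x - z i)
    linarith

theorem continuous_pairIncrement (hG : SmoothStep ε r G) (h : ℝ) (n j : ℤ) :
    Continuous (pairIncrement G z h n j) := by
  have := hG.continuous
  unfold pairIncrement
  fun_prop

theorem pairIncrement_add_period (hz : PeriodicSeq T l z) (h : ℝ) (n j k : ℤ) (x : ℝ) :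
    pairIncrement G z h n (k * T + j) x = pairIncrement G z h n j (x - k * T) := by
  have h1 := hz.add_mul_period (j + n) k
  have h2 := hz.add_mul_period j k
  unfold pairIncrement
  rw [show k * T + j + n = j + n + k * T by ring, show k * T + j = j + k * T by ring, h1, h2]
  ring_nf

theorem integral_pairIncrement (h : ℝ) (n j : ℤ) :
    ∫ x, ψ (pairIncrement G z h n j x) = shiftCost ψ G (h - (z (j + n) - z j)) := by
  unfold shiftCost pairIncrement
  rw [← integral_add_right_eq_self _ (z j)]
  congr 1
  ext x
  ring_nf

/-- The interval is the union of the `2 * K` translates of a period that arise when the integral is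
unfolded; `6 * T` generously absorbs the distances between `z j` and `j` and the size of `i`. -/
theorem support_pairIncrement_subset (hG : SmoothStep ε r G) (hz : PeriodicSeq T l z)
    (h0 : ψ 0 = 0) {h : ℝ} {n : ℤ} {i : ℕ} (hi : i < T) {K : ℕ}
    (hK : ε + |h| + |(n : ℝ)| + 6 * T < K * T) :
    Function.support (fun x => ψ (pairIncrement G z h n i x)) ⊆
      Ioc ((1 - K : ℝ) * T) ((K + 1 : ℝ) * T) := by
  intro x hx
  have hz1 := abs_le.1 (hz.dist_le i)
  have hz2 := abs_le.1 (hz.dist_le (i + n))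
  have hi' : (i : ℝ) < T := by exact_mod_cast hi
  have hi0 : (0 : ℝ) ≤ i := Nat.cast_nonneg i
  have hh := abs_le.1 (le_refl |h|)
  have hn := abs_le.1 (le_refl |(n : ℝ)|)
  push_cast at hz1 hz2
  have hτ : |h - (z (i + n) - z i)| ≤ |h| + |(n : ℝ)| + 2 * T := by
    rw [abs_le]; constructor <;> linarith
  have hlt : |x - z i| < ε + |h - (z (i + n) - z i)| := by
    by_contra hcon
    apply hx
    have := hG.shift_sub_eq_zero (not_lt.1 hcon)
    simp only [pairIncrement]
    rw [show x + h - z (i + n) = x - z i + (h - (z (i + n) - z i)) by ring, this, h0]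
  have := abs_lt.1 hlt
  constructor <;> linarith

/-- Unfolding: labels in the window split as `(k - K) * T + i`. A shift of the label by whole
periods is a translation in `x`, so for fixed `i` the periods tile an interval containing the
support, and the integral runs over the whole line. -/
theorem integral_sum_pairIncrement (hG : SmoothStep ε r G) (hz : PeriodicSeq T l z)
    (hψ : Continuous ψ) (h0 : ψ 0 = 0) {h : ℝ} {n : ℤ} {K : ℕ}
    (hK : ε + |h| + |(n : ℝ)| + 6 * T < K * T) :
    ∫ x in (0 : ℝ)..T, ∑ j ∈ Finset.Ico (-((K * T : ℕ) : ℤ)) (K * T : ℕ),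
        ψ (pairIncrement G z h n j x) =
      ∑ i ∈ Finset.range T, shiftCost ψ G (h - (z (i + n) - z i)) := by
  have hc : ∀ j, Continuous fun x => ψ (pairIncrement G z h n j x) := fun j =>
    hψ.comp (continuous_pairIncrement hG h n j)
  rw [intervalIntegral.integral_finsetSum fun j _ => (hc j).intervalIntegrable _ _,
    Finset.sum_Ico_int_block, Finset.sum_comm]
  refine Finset.sum_congr rfl fun i hi => ?_
  have hi' := Finset.mem_range.1 hi
  rw [← integral_pairIncrement,
    ← intervalIntegral.integral_eq_integral_of_support_subset
      (support_pairIncrement_subset hG hz h0 hi' hK)]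
  -- The translated intervals move left as `k` grows; reversing their endpoints makes consecutive
  -- ones adjacent.
  have h1 : ∀ k : ℕ, ∫ x in (0 : ℝ)..T, ψ (pairIncrement G z h n (((k : ℤ) - K) * T + i) x) =
      -∫ x in ((K + 1 : ℝ) - k) * T..((K + 1 : ℝ) - (k + 1 : ℕ)) * T,
        ψ (pairIncrement G z h n i x) := by
    intro k
    rw [← intervalIntegral.integral_symm]
    simp only [pairIncrement_add_period hz]
    rw [intervalIntegral.integral_comp_sub_right
      (fun x => ψ (pairIncrement G z h n i x))]
    congr 1 <;> push_cast <;> ring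
  simp only [h1, Finset.sum_neg_distrib]
  rw [intervalIntegral.sum_integral_adjacent_intervals
    (a := fun k : ℕ => ((K + 1 : ℝ) - k) * T) fun k _ => (hc i).intervalIntegrable _ _,
    ← intervalIntegral.integral_symm]
  congr 1 <;> push_cast <;> ring

/-- `v` is a primitive of `1 - ∑ⱼ r (y - z_j)`. -/
def IsSmoothDisplacement (T : ℕ) (ε : ℝ) (r : ℝ → ℝ) (z : ℤ → ℝ) (v : ℝ → ℝ) : Prop :=
  ∀ (N : ℕ) (y : ℝ), |y| + ε + T ≤ N →
    HasDerivAt v (1 - ∑ j ∈ Finset.Ico (-(N : ℤ)) N, r (y - z j)) y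

/-- On the segment from `x` to `x + h` the function `v y - y + ∑ G (y - z j)` is constant.
Reindexing the sum at `x + h` by `n` then costs exactly `n`. -/
theorem IsSmoothDisplacement.sub_eq {v : ℝ → ℝ} (hv : IsSmoothDisplacement T ε r z v)
    (hG : SmoothStep ε r G) (hz : PeriodicSeq T l z) {x h : ℝ} {n : ℤ} {N : ℕ}
    (hN : |x| + |h| + ε + T + 1 + |(n : ℝ)| ≤ N) (hε : 0 ≤ ε) :
    v (x + h) - v x = (h - n) - ∑ j ∈ Finset.Ico (-(N : ℤ)) N, pairIncrement G z h n j x := by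
  have hn := abs_nonneg (n : ℝ)
  have h1 : ∀ y ∈ uIcc x (x + h), HasDerivAt
      (fun y => v y - y + ∑ j ∈ Finset.Ico (-(N : ℤ)) N, G (y - z j)) 0 y := by
    intro y hy
    have hy' : |y| ≤ |x| + |h| := by
      have e1 := abs_sub_left_of_mem_uIcc hy
      have e2 : |y| ≤ |y - x| + |x| := by simpa using abs_add_le (y - x) x
      rw [add_sub_cancel_left] at e1
      linarith
    have d1 := hv N y (by linarith)
    have d2 : HasDerivAt (fun y => ∑ j ∈ Finset.Ico (-(N : ℤ)) N, G (y - z j))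
        (∑ j ∈ Finset.Ico (-(N : ℤ)) N, r (y - z j)) y :=
      HasDerivAt.fun_sum fun j _ => (hG.hasDeriv (y - z j)).comp_sub_const y (z j)
    have d3 := (d1.sub (hasDerivAt_id y)).add d2
    rw [sub_right_comm, sub_self, zero_sub, neg_add_cancel] at d3
    exact d3
  have h2 := intervalIntegral.integral_eq_sub_of_hasDerivAt h1 (by simp)
  rw [intervalIntegral.integral_zero] at h2
  -- For labels beyond `M` in absolute value, the steps seen from `x + h` are saturated at `1` or
  -- `0`; rounding up costs the `+ 1` in `hN`.
  obtain ⟨M, hM1, hM2⟩ : ∃ M : ℕ, |x| + |h| + ε + T ≤ M ∧ (M : ℝ) < |x| + |h| + ε + T + 1 :=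
    ⟨_, Nat.le_ceil _, Nat.ceil_lt_add_one (by positivity)⟩
  have hx := abs_le.1 (le_refl |x|)
  have hh := abs_le.1 (le_refl |h|)
  have h3 := Finset.sum_Ico_int_shift_sub (a := fun j => G (x + h - z j)) (M := M) (N := N)
    (n := n) (by omega) (by
      have : (M : ℝ) + |(n : ℝ)| ≤ N := by linarith
      exact_mod_cast this)
    (fun j hj => hG.eq_one _ (by
      have := abs_le.1 (hz.dist_le j)
      have : (j : ℝ) ≤ -M := by exact_mod_cast hj
      linarith))
    (fun j hj => hG.eq_zero _ (by
      have := abs_le.1 (hz.dist_le j)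
      have : (M : ℝ) ≤ j := by exact_mod_cast hj
      linarith))
  simp only [pairIncrement, Finset.sum_sub_distrib]
  linarith

/-- The `p`-th power of the `L^p` norm over a period of the increment `v (x + h) - v x`. -/
noncomputable def incrementEnergy (T : ℕ) (p : ℝ) (v : ℝ → ℝ) (h : ℝ) : ℝ :=
  ∫ x in (0 : ℝ)..T, |v (x + h) - v x| ^ p

theorem exists_incrementEnergy_eq {v : ℝ → ℝ} (hv : IsSmoothDisplacement T ε r z v)
    (hG : SmoothStep ε r G) (hz : PeriodicSeq T l z) (hT : 0 < T) (hε : 0 ≤ ε)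
    {p : ℝ} (hp : 1 < p) (h : ℝ) (n : ℤ) :
    ∃ K : ℕ, ε + |h| + |(n : ℝ)| + 6 * T < K * T ∧ incrementEnergy T p v h =
      T * |h - n| ^ p + ∫ x in (0 : ℝ)..T, powerCost p (h - n)
        (∑ j ∈ Finset.Ico (-((K * T : ℕ) : ℤ)) (K * T : ℕ), pairIncrement G z h n j x) := by
  have hT' : (1 : ℝ) ≤ T := by exact_mod_cast hT
  obtain ⟨K, hK⟩ := exists_nat_gt (ε + |h| + |(n : ℝ)| + 6 * T)
  have hK' : ε + |h| + |(n : ℝ)| + 6 * T < K * T :=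
    hK.trans_le (le_mul_of_one_le_right (Nat.cast_nonneg K) hT')
  refine ⟨K, hK', ?_⟩
  have hc : Continuous fun x => powerCost p (h - n)
      (∑ j ∈ Finset.Ico (-((K * T : ℕ) : ℤ)) (K * T : ℕ), pairIncrement G z h n j x) :=
    (contDiff_powerCost hp _).continuous.comp
      (continuous_finsetSum _ fun j _ => continuous_pairIncrement hG h n j)
  have : (T : ℝ) * |h - n| ^ p = ∫ x in (0 : ℝ)..T, |h - n| ^ p := by simp
  rw [this, ← intervalIntegral.integral_add (by simp) (hc.intervalIntegrable _ _)]
  refine intervalIntegral.integral_congr fun x hx => ?_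
  rw [uIcc_of_le (by linarith)] at hx
  have e := hv.sub_eq hG hz (x := x) (h := h) (n := n) (N := K * T) (by
    rw [abs_of_nonneg hx.1]
    push_cast
    linarith [hx.2]) hε
  simp only [powerCost]
  rw [e]
  ring

theorem le_incrementEnergy {v : ℝ → ℝ} (hv : IsSmoothDisplacement T ε r z v)
    (hG : SmoothStep ε r G) (hz : PeriodicSeq T l z) (hl : 2 * ε ≤ l) (hT : 0 < T)
    (hε : 0 ≤ ε) {p : ℝ} (hp : 1 < p) (h : ℝ) (n : ℤ) :
    T * |h - n| ^ p + ∑ i ∈ Finset.range T,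
      shiftCost (powerCost p (h - n)) G (h - (z (i + n) - z i)) ≤ incrementEnergy T p v h := by
  obtain ⟨K, hK, e⟩ := exists_incrementEnergy_eq hv hG hz hT hε hp h n
  have hψ := (contDiff_powerCost hp (h - n)).continuous
  rw [e, ← integral_sum_pairIncrement hG hz hψ (powerCost_zero _ _) hK]
  gcongr
  refine intervalIntegral.integral_mono_on (Nat.cast_nonneg T) ?_ ?_ fun x _ =>
    (convexOn_powerCost hp.le _).sum_le_of_same_sign (powerCost_zero _ _) _
      (pairIncrement_same_sign hG hz hl h n x)
  · exact Continuous.intervalIntegrable (continuous_finsetSum _ fun j _ =>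
      hψ.comp (continuous_pairIncrement hG h n j)) _ _
  · exact Continuous.intervalIntegrable (hψ.comp (continuous_finsetSum _ fun j _ =>
      continuous_pairIncrement hG h n j)) _ _

/-- Jensen with equal weights `1 / T`: the shifts `h - (z (i + n) - z i)` have mean `h - n`. -/
theorem mul_le_incrementEnergy {v : ℝ → ℝ} (hv : IsSmoothDisplacement T ε r z v)
    (hG : SmoothStep ε r G) (hz : PeriodicSeq T l z) (hl : 2 * ε ≤ l) (hT : 0 < T)
    (hε : 0 ≤ ε) {p : ℝ} (hp : 1 < p) (h : ℝ) (n : ℤ) :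
    T * (|h - n| ^ p + shiftCost (powerCost p (h - n)) G (h - n)) ≤ incrementEnergy T p v h := by
  refine le_trans ?_ (le_incrementEnergy hv hG hz hl hT hε hp h n)
  have hT' : (0 : ℝ) < T := by exact_mod_cast hT
  have hc := hG.convexOn_shiftCost (contDiff_powerCost hp (h - n)) (convexOn_powerCost hp.le _)
    (powerCost_zero _ _)
  have J := hc.map_sum_le (t := Finset.range T) (w := fun _ => (T : ℝ)⁻¹)
    (p := fun i => h - (z (i + n) - z i)) (fun _ _ => by positivity)
    (by simp [hT'.ne']) (fun _ _ => mem_univ _)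
  simp only [smul_eq_mul, ← Finset.mul_sum] at J
  rw [Finset.sum_sub_distrib, hz.sum_shift_sub] at J
  have e : (T : ℝ)⁻¹ * (∑ _i ∈ Finset.range T, h - n * T) = h - n := by
    simp only [Finset.sum_const, Finset.card_range, nsmul_eq_mul]
    field_simp
  rw [e, ← div_eq_inv_mul, le_div_iff₀ hT'] at J
  linarith

/-- For the lattice every shift equals `h - n`, and `2 * ε + |h - n| ≤ 1` leaves at most one nonzero
pair increment at each `x`, so nothing is lost in superadditivity or Jensen. -/
theorem incrementEnergy_eq_of_intCast {v : ℝ → ℝ}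
    (hv : IsSmoothDisplacement T ε r (fun j => (j : ℝ)) v)
    (hG : SmoothStep ε r G) (hT : 0 < T) (hε : 0 ≤ ε) (hε1 : 4 * ε ≤ 1) {p : ℝ} (hp : 1 < p)
    (h : ℝ) {n : ℤ} (hn : |h - n| ≤ 1 / 2) :
    incrementEnergy T p v h =
      T * (|h - n| ^ p + shiftCost (powerCost p (h - n)) G (h - n)) := by
  have hz := periodicSeq_intCast T
  obtain ⟨K, hK, e⟩ := exists_incrementEnergy_eq hv hG hz hT hε hp h n
  have hψ := (contDiff_powerCost hp (h - n)).continuous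
  have hθ := abs_le.1 hn
  have hs : ∀ x i j, i ≠ j → pairIncrement G (fun j => (j : ℝ)) h n i x = 0 ∨
      pairIncrement G (fun j => (j : ℝ)) h n j x = 0 := by
    intro x
    have key : ∀ i j : ℤ, i < j → pairIncrement G (fun j => (j : ℝ)) h n i x = 0 ∨
        pairIncrement G (fun j => (j : ℝ)) h n j x = 0 := by
      intro i j hij
      have hij' : (i : ℝ) + 1 ≤ j := by exact_mod_cast hij
      simp only [pairIncrement]
      push_cast
      -- If either step of the pair `i` is not yet saturated, both steps of a later pair are still
      -- `0`: their arguments are at most `ε - 1 + 1 / 2 ≤ -ε`.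
      by_cases hc : ε ≤ x - i ∧ ε ≤ x + h - (i + n)
      · left
        rw [hG.eq_one _ hc.1, hG.eq_one _ hc.2, sub_self]
      · right
        rw [not_and_or, not_le, not_le] at hc
        rw [hG.eq_zero, hG.eq_zero, sub_self]
        · rcases hc with hc | hc <;> linarith
        · rcases hc with hc | hc <;> linarith
    intro i j hij
    rcases lt_or_gt_of_ne hij with hlt | hlt
    · exact key i j hlt
    · exact (key j i hlt).symm
  have hcongr : ∀ x, powerCost p (h - n) (∑ j ∈ Finset.Ico (-((K * T : ℕ) : ℤ)) (K * T : ℕ),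
      pairIncrement G (fun j => (j : ℝ)) h n j x) = _ := fun x =>
    apply_sum_eq_of_subsingleton_support (powerCost_zero _ _) _ (hs x)
  rw [e]
  simp only [hcongr]
  rw [integral_sum_pairIncrement hG hz hψ (powerCost_zero _ _) hK]
  have : ∀ i : ℕ, h - ((((i : ℤ) + n : ℤ) : ℝ) - ((i : ℤ) : ℝ)) = h - n := fun i => by
    push_cast; ring
  simp only [this, Finset.sum_const, Finset.card_range, nsmul_eq_mul]
  ring

end

/-! ### Mollified displacements -/

/-- The rescaled density `x ↦ ε⁻¹ ρ (x / ε)`. -/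
noncomputable def rescale (ρ : ℝ → ℝ) (ε : ℝ) (x : ℝ) : ℝ := ε⁻¹ * ρ (x / ε)

namespace IsMollifier

variable {ρ : ℝ → ℝ} {ε : ℝ}

theorem contDiff_rescale (hρ : IsMollifier ρ) (ε : ℝ) : ContDiff ℝ ∞ (rescale ρ ε) :=
  contDiff_const.mul (hρ.contDiff.comp (contDiff_id.div_const ε))

theorem rescale_eq_zero (hρ : IsMollifier ρ) (hε : 0 < ε) {x : ℝ} (hx : ε ≤ |x|) :
    rescale ρ ε x = 0 := by
  have : ρ (x / ε) = 0 := by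
    by_contra h
    have h1 := abs_lt.2 (hρ.support_subset h)
    rw [abs_div, abs_of_pos hε, div_lt_one hε] at h1
    linarith
  rw [rescale, this, mul_zero]

theorem integral_rescale (hρ : IsMollifier ρ) (hε : 0 < ε) : ∫ x, rescale ρ ε x = 1 := by
  unfold rescale
  rw [integral_const_mul, Measure.integral_comp_div, hρ.integral_eq_one, abs_of_pos hε,
    smul_eq_mul, mul_one, inv_mul_cancel₀ hε.ne']

theorem exists_smoothStep (hρ : IsMollifier ρ) (hε : 0 < ε) :
    ∃ G, SmoothStep ε (rescale ρ ε) G := by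
  have hc := (hρ.contDiff_rescale ε).continuous
  have hz : ∀ x, ε ≤ |x| → rescale ρ ε x = 0 := fun x hx => hρ.rescale_eq_zero hε hx
  refine ⟨fun x => ∫ t in -ε..x, rescale ρ ε t, hc, fun x =>
    mul_nonneg (inv_nonneg.2 hε.le) (hρ.nonneg _), hz, fun x =>
    intervalIntegral.integral_hasDerivAt_right (hc.intervalIntegrable _ _)
      (hc.stronglyMeasurableAtFilter _ _) hc.continuousAt, fun x hx => ?_, fun x hx => ?_⟩
  · refine intervalIntegral.integral_zero_ae (Filter.Eventually.of_forall fun t ht => ?_)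
    rw [uIoc_of_ge hx] at ht
    exact hz t (le_abs.2 (Or.inr (by linarith [ht.2])))
  · refine (intervalIntegral.integral_eq_integral_of_support_subset ?_).trans
      (hρ.integral_rescale hε)
    intro t ht
    have := abs_lt.1 (not_le.1 fun h => ht (hz t h))
    exact ⟨this.1, by linarith⟩

theorem hasCompactSupport_rescale (hρ : IsMollifier ρ) (hε : 0 < ε) :
    HasCompactSupport (rescale ρ ε) :=
  (hρ.exists_smoothStep hε).choose_spec.hasCompactSupport

end IsMollifier

namespace Configuration

variable {T : ℕ} {ρ : ℝ → ℝ} {ε : ℝ}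

theorem isDisplacement_displacement (X : Configuration T) : X.IsDisplacement X.displacement :=
  Classical.choose_spec X.exists_isDisplacement

/-- The derivative falls on the kernel, and the weak equation is tested with `t ↦ rescale ρ ε (y -
t)`, whose integral is `1`. Only the defining properties of the displacement enter, so the choice of
representative is immaterial. -/
theorem hasDerivAt_mollify (X : Configuration T) (hρ : IsMollifier ρ) (hε : 0 < ε) (y : ℝ) :
    HasDerivAt (mollify ρ ε X.displacement)
      (1 - ∑ i, ∑' k : ℤ, rescale ρ ε (y - X.point (i, k))) y := by
  have hu := X.isDisplacement_displacement
  have hk := hρ.contDiff_rescale ε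
  have hkc := hρ.hasCompactSupport_rescale hε
  have h1 := hkc.hasDerivAt_convolution_right (ContinuousLinearMap.mul ℝ ℝ) hu.locallyIntegrable
    (hk.of_le (by simp)) y
  have hd : ∀ t, deriv (fun t => rescale ρ ε (y - t)) t = -deriv (rescale ρ ε) (y - t) :=
    fun t => deriv_comp_const_sub (f := rescale ρ ε) y t
  have h2 := hu.weakDeriv (fun t => rescale ρ ε (y - t))
    (hk.comp (contDiff_const.sub contDiff_id))
    (hkc.comp_homeomorph (Homeomorph.subLeft y))
  rw [integral_sub_left_eq_self (rescale ρ ε), hρ.integral_rescale hε] at h2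
  have h3 : convolution X.displacement (deriv (rescale ρ ε))
      (ContinuousLinearMap.mul ℝ ℝ) volume y =
      -∫ t, X.displacement t * deriv (fun t => rescale ρ ε (y - t)) t := by
    simp only [hd, convolution, ContinuousLinearMap.mul_apply', mul_neg, integral_neg, neg_neg]
  rw [h3, h2] at h1
  exact h1

theorem contDiff_mollify (X : Configuration T) (hρ : IsMollifier ρ) (hε : 0 < ε) :
    ContDiff ℝ 1 (mollify ρ ε X.displacement) :=
  (hρ.hasCompactSupport_rescale hε).contDiff_convolution_right (ContinuousLinearMap.mul ℝ ℝ)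
    X.isDisplacement_displacement.locallyIntegrable ((hρ.contDiff_rescale ε).of_le (by simp))

theorem periodic_mollify (X : Configuration T) (ρ : ℝ → ℝ) (ε : ℝ) :
    Function.Periodic (mollify ρ ε X.displacement) T := by
  intro x
  change ∫ t, X.displacement t * rescale ρ ε (x + T - t) =
    ∫ t, X.displacement t * rescale ρ ε (x - t)
  rw [← integral_add_right_eq_self _ (T : ℝ)]
  refine integral_congr_ae ?_
  filter_upwards [X.isDisplacement_displacement.periodic] with t ht
  rw [ht, add_sub_add_right_eq_sub]

theorem rescale_sub_eq_zero (hρ : IsMollifier ρ) (hε : 0 < ε) (y t : ℝ) (ht : |y| + ε ≤ |t|) :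
    rescale ρ ε (y - t) = 0 := by
  apply hρ.rescale_eq_zero hε
  have := abs_sub_abs_le_abs_sub t y
  rw [abs_sub_comm] at this
  linarith

theorem isSmoothDisplacement_mollify [NeZero T] (X : Configuration T) (hρ : IsMollifier ρ)
    (hε : 0 < ε) :
    IsSmoothDisplacement T ε (rescale ρ ε) X.enum (mollify ρ ε X.displacement) := by
  intro N y hN
  have := X.hasDerivAt_mollify hρ hε y
  rwa [X.sum_tsum_point_eq_sum_enum (f := fun t => rescale ρ ε (y - t))
    (rescale_sub_eq_zero hρ hε y) hN] at this

theorem exists_lipschitzWith_mollify (X : Configuration T) (hT : 0 < T) (hρ : IsMollifier ρ)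
    (hε : 0 < ε) : ∃ L, LipschitzWith L (mollify ρ ε X.displacement) := by
  have hc := X.contDiff_mollify hρ hε
  have hp : Function.Periodic (deriv (mollify ρ ε X.displacement)) T := by
    intro x
    rw [← deriv_comp_add_const]
    congr 1
    exact funext (X.periodic_mollify ρ ε)
  obtain ⟨L, hL⟩ := (hp.isBounded_of_continuous (by positivity)
    (hc.continuous_deriv (by simp))).exists_norm_le
  refine ⟨L.toNNReal, lipschitzWith_of_nnnorm_deriv_le (hc.differentiable (by simp)) fun x => ?_⟩
  rw [← NNReal.coe_le_coe, coe_nnnorm]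
  exact (hL _ (mem_range_self x)).trans (Real.le_coe_toNNReal L)

end Configuration

/-! ### The energy as an integral over increments, and its finiteness -/

section energy

variable {T : ℕ} {s p : ℝ} {v : ℝ → ℝ}

theorem incrementEnergy_nonneg (T : ℕ) (p : ℝ) (v : ℝ → ℝ) (h : ℝ) :
    0 ≤ incrementEnergy T p v h :=
  intervalIntegral.integral_nonneg (Nat.cast_nonneg T) fun _ _ => by positivity

theorem continuous_incrementEnergy (hv : Continuous v) (hp : 0 ≤ p) :
    Continuous (incrementEnergy T p v) := by
  refine intervalIntegral.continuous_parametric_intervalIntegral_of_continuous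
    (f := fun h x => |v (x + h) - v x| ^ p) ?_ continuous_const
  exact Continuous.rpow_const (by fun_prop) fun _ => Or.inr hp

theorem gagliardoEnergy_eq_lintegral_incrementEnergy (hv : Continuous v) (hp : 0 ≤ p) :
    gagliardoEnergy T s p v =
      ∫⁻ h, ENNReal.ofReal (incrementEnergy T p v h / |h| ^ (1 + s * p)) := by
  unfold gagliardoEnergy
  have h1 : ∀ x, ∫⁻ y, ENNReal.ofReal (|v x - v y| ^ p / |x - y| ^ (1 + s * p)) =
      ∫⁻ h, ENNReal.ofReal (|v (x + h) - v x| ^ p / |h| ^ (1 + s * p)) := by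
    intro x
    rw [← lintegral_add_left_eq_self _ x]
    simp only [sub_add_cancel_left, abs_neg, abs_sub_comm (v x)]
  simp only [h1]
  rw [lintegral_lintegral_swap]
  · refine lintegral_congr fun h => ?_
    have hc : Continuous fun x => |v (x + h) - v x| ^ p / |h| ^ (1 + s * p) :=
      (Continuous.rpow_const (by fun_prop) fun _ => Or.inr hp).div_const _
    rw [← ofReal_integral_eq_lintegral_ofReal (hc.integrableOn_Icc)
      (Filter.Eventually.of_forall fun x => by positivity), integral_Icc_eq_integral_Ioc,
      ← intervalIntegral.integral_of_le (Nat.cast_nonneg T), intervalIntegral.integral_div,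
      incrementEnergy]
  · refine Measurable.aemeasurable ?_
    have hm := hv.measurable
    simp only [Function.uncurry_def]
    fun_prop

theorem incrementEnergy_le {C : ℝ} (hv : Continuous v) (hp : 0 ≤ p) {h : ℝ}
    (hC : ∀ x, |v (x + h) - v x| ≤ C) : incrementEnergy T p v h ≤ T * C ^ p := by
  have e : (T : ℝ) * C ^ p = ∫ x in (0 : ℝ)..T, C ^ p := by simp
  rw [e]
  refine intervalIntegral.integral_mono_on (Nat.cast_nonneg T) ?_ (by simp) fun x _ =>
    Real.rpow_le_rpow (abs_nonneg _) (hC x) hp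
  exact Continuous.intervalIntegrable
    (Continuous.rpow_const (by fun_prop) fun _ => Or.inr hp) _ _

theorem integrable_piecewise_abs_rpow {a b : ℝ} (ha : -1 < a) (hb : b < -1) :
    Integrable fun h : ℝ => if |h| ≤ 1 then |h| ^ a else |h| ^ b := by
  have := (integrable_fun_norm_addHaar (volume : Measure ℝ)
    (f := fun y : ℝ => if y ≤ 1 then y ^ a else y ^ b)).2 ?_
  · simpa using this
  · simp only [Module.finrank_self, Nat.sub_self, pow_zero, one_smul]
    rw [← Ioc_union_Ioi_eq_Ioi zero_le_one]
    refine IntegrableOn.union ?_ ?_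
    · refine IntegrableOn.congr_fun (f := fun y : ℝ => y ^ a) ?_ (fun y hy => ?_)
        measurableSet_Ioc
      · exact (intervalIntegrable_iff_integrableOn_Ioc_of_le zero_le_one).1
          (intervalIntegral.intervalIntegrable_rpow' ha)
      · simp [hy.2]
    · refine IntegrableOn.congr_fun (f := fun y : ℝ => y ^ b)
        (integrableOn_Ioi_rpow_of_lt hb one_pos) (fun y hy => ?_) measurableSet_Ioi
      simp [not_le.2 (mem_Ioi.1 hy)]

/-- Near `h = 0` the Lipschitz bound gives the exponent `p - (1 + s * p) > -1`, because `s < 1`; for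
large `|h|` boundedness gives `-(1 + s * p) < -1`. Finiteness is what lets equality of energies
force equality of the integrands almost everywhere. -/
theorem gagliardoEnergy_ne_top {L : NNReal} (hv : LipschitzWith L v)
    (hper : Function.Periodic v T) (hT : 0 < T) (hp : 0 < p) (hs0 : 0 < s) (hs1 : s < 1) :
    gagliardoEnergy T s p v ≠ ⊤ := by
  have hc := hv.continuous
  rw [gagliardoEnergy_eq_lintegral_incrementEnergy hc hp.le]
  obtain ⟨M, hM⟩ := (hper.isBounded_of_continuous (by positivity) hc).exists_norm_le
  have hM' : ∀ x, |v x| ≤ M := fun x => hM _ (mem_range_self x)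
  have hM0 : 0 ≤ M := (abs_nonneg _).trans (hM' 0)
  set C : ℝ := T * (L : ℝ) ^ p + T * (2 * M) ^ p with hC
  have hC1 : T * (L : ℝ) ^ p ≤ C := le_add_of_nonneg_right (by positivity)
  have hC2 : T * (2 * M) ^ p ≤ C := le_add_of_nonneg_left (by positivity)
  have hsp : 0 < s * p := by positivity
  have hsp1 : s * p < p := by nlinarith
  have hint := (integrable_piecewise_abs_rpow (a := p - (1 + s * p)) (b := -(1 + s * p))
    (by linarith) (by linarith)).const_mul C
  refine ((lintegral_mono_ae ?_).trans_lt hint.lintegral_lt_top).ne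
  filter_upwards [compl_mem_ae_iff.2 (measure_singleton (0 : ℝ))] with h hh
  have hpos : 0 < |h| := abs_pos.2 hh
  refine ENNReal.ofReal_le_ofReal ?_
  rw [div_le_iff₀ (by positivity)]
  split_ifs with h1
  · rw [mul_assoc, ← Real.rpow_add hpos, sub_add_cancel]
    have := incrementEnergy_le (T := T) hc hp.le (h := h) (C := L * |h|) fun x => by
      have := hv.dist_le_mul (x + h) x
      simpa [Real.dist_eq] using this
    rw [Real.mul_rpow L.coe_nonneg (abs_nonneg h), ← mul_assoc] at this
    exact this.trans (by gcongr)
  · rw [mul_assoc, ← Real.rpow_add hpos, neg_add_cancel, Real.rpow_zero, mul_one]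
    refine (incrementEnergy_le (T := T) hc hp.le (h := h) (C := 2 * M) fun x => ?_).trans hC2
    have := abs_sub (v (x + h)) (v x)
    linarith [hM' (x + h), hM' x]

end energy

/-! ### Minimality and uniqueness -/

/-- At `θ = 0` the cost is `∫ |G (x + τ) - G x| ^ p`; if it vanishes, `τ` is a period of `G`. -/
theorem SmoothStep.eq_zero_of_shiftCost_eq_zero {ε p τ : ℝ} {r G : ℝ → ℝ}
    (h : SmoothStep ε r G) (hp : 1 < p) (hτ : shiftCost (powerCost p 0) G τ = 0) : τ = 0 := by
  have hψ := (contDiff_powerCost hp 0).continuous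
  have hG := h.continuous
  have e : ∀ t, powerCost p 0 t = |t| ^ p := fun t => by
    simp [powerCost, Real.zero_rpow (by linarith : p ≠ 0)]
  have h1 := (integral_eq_zero_iff_of_nonneg (fun x => by simp only [e, Pi.zero_apply]; positivity)
    (h.integrable_shift hψ (powerCost_zero p 0) τ)).1 hτ
  have h2 := (Continuous.ae_eq_iff_eq volume (by fun_prop) continuous_const).1 h1
  refine h.eq_zero_of_shift_eq fun x => ?_
  have h3 : |G (x + τ) - G x| ^ p = 0 := (e _).symm.trans (congrFun h2 x)
  rw [Real.rpow_eq_zero (abs_nonneg _) (by linarith)] at h3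
  linarith [abs_eq_zero.1 h3]

namespace Configuration

variable {T : ℕ} {ρ : ℝ → ℝ} {ε s p : ℝ}

theorem incrementEnergy_equispaced_le [NeZero T] (hρ : IsMollifier ρ) (hε : 0 < ε)
    (hε1 : 4 * ε ≤ 1) (hp : 1 < p) {X : Configuration T} (hX : X ∈ regular T (4 * ε)) (h : ℝ) :
    incrementEnergy T p (mollify ρ ε (equispaced T).displacement) h ≤
      incrementEnergy T p (mollify ρ ε X.displacement) h := by
  obtain ⟨G, hG⟩ := hρ.exists_smoothStep hε
  have hT := Nat.pos_of_neZero T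
  have h1 := (equispaced T).isSmoothDisplacement_mollify hρ hε
  rw [funext enum_equispaced] at h1
  -- The choice `n = round h` ensures `|h - n| ≤ 1 / 2`.
  rw [incrementEnergy_eq_of_intCast h1 hG hT hε.le hε1 hp h (abs_sub_round h)]
  exact mul_le_incrementEnergy (X.isSmoothDisplacement_mollify hρ hε) hG (periodicSeq_enum hX)
    (by linarith) hT hε.le hp h _

theorem mollifiedEnergy_eq_lintegral (X : Configuration T) (hρ : IsMollifier ρ) (hε : 0 < ε)
    (hp : 1 < p) : mollifiedEnergy s p ρ ε X = ∫⁻ h, ENNReal.ofReal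
      (incrementEnergy T p (mollify ρ ε X.displacement) h / |h| ^ (1 + s * p)) :=
  gagliardoEnergy_eq_lintegral_incrementEnergy (X.contDiff_mollify hρ hε).continuous (by linarith)

theorem isMinOn_equispaced [NeZero T] (hρ : IsMollifier ρ) (hε : 0 < ε)
    (hε1 : 4 * ε ≤ 1) (hp : 1 < p) :
    IsMinOn (mollifiedEnergy s p ρ ε) (regular T (4 * ε)) (equispaced T) := by
  refine isMinOn_iff.2 fun X hX => ?_
  rw [mollifiedEnergy_eq_lintegral _ hρ hε hp, mollifiedEnergy_eq_lintegral _ hρ hε hp]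
  refine lintegral_mono fun h => ENNReal.ofReal_le_ofReal ?_
  gcongr
  exact incrementEnergy_equispaced_le hρ hε hε1 hp hX h

/-- After translation the two mollified displacements have the same derivative, so they differ by a
constant, which increments do not see. The remaining translation is absorbed by periodicity. -/
theorem mollifiedEnergy_eq_of_isTranslate [NeZero T] (hρ : IsMollifier ρ) (hε : 0 < ε)
    (hp : 1 < p) {X Y : Configuration T} (hXY : X.IsTranslate Y) :
    mollifiedEnergy s p ρ ε X = mollifiedEnergy s p ρ ε Y := by
  obtain ⟨a, e, he⟩ := hXY
  have hd : ∀ y, HasDerivAt (fun y => mollify ρ ε X.displacement y -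
      mollify ρ ε Y.displacement (y - a)) 0 y := by
    intro y
    have h1 := X.hasDerivAt_mollify hρ hε y
    have h2 := (Y.hasDerivAt_mollify hρ hε (y - a)).comp_sub_const y a
    rw [X.sum_tsum_point (f := fun t => rescale ρ ε (y - t)) (rescale_sub_eq_zero hρ hε y),
      ← e.tsum_eq] at h1
    rw [Y.sum_tsum_point (f := fun t => rescale ρ ε (y - a - t))
      (rescale_sub_eq_zero hρ hε (y - a))] at h2
    have h3 := h1.sub h2
    simp only [he, ← sub_sub, sub_right_comm y _ a, sub_self] at h3
    exact h3
  have hc := is_const_of_deriv_eq_zero (fun y => (hd y).differentiableAt) fun y => (hd y).deriv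
  rw [mollifiedEnergy_eq_lintegral _ hρ hε hp, mollifiedEnergy_eq_lintegral _ hρ hε hp]
  refine lintegral_congr fun h => ?_
  congr 2
  unfold incrementEnergy
  have h1 : ∀ x, mollify ρ ε X.displacement (x + h) - mollify ρ ε X.displacement x =
      mollify ρ ε Y.displacement (x - a + h) - mollify ρ ε Y.displacement (x - a) := by
    intro x
    have := hc (x + h) x
    rw [show x - a + h = x + h - a by ring]
    linarith
  simp only [h1]
  rw [intervalIntegral.integral_comp_sub_right
    (fun x => |mollify ρ ε Y.displacement (x + h) - mollify ρ ε Y.displacement x| ^ p)]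
  have hper : Function.Periodic
      (fun x => |mollify ρ ε Y.displacement (x + h) - mollify ρ ε Y.displacement x| ^ p) T := by
    intro x
    simp only
    rw [Y.periodic_mollify ρ ε x, show x + T + h = x + h + T by ring,
      Y.periodic_mollify ρ ε (x + h)]
  have := hper.intervalIntegral_add_eq (0 - a) 0
  rwa [zero_add, show (0 : ℝ) - a + T = T - a by ring] at this

theorem incrementEnergy_eq_of_mollifiedEnergy_le [NeZero T] (hρ : IsMollifier ρ) (hε : 0 < ε)
    (hε1 : 4 * ε ≤ 1) (hp : 1 < p) (hs0 : 0 < s) (hs1 : s < 1) {X : Configuration T}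
    (hX : X ∈ regular T (4 * ε))
    (hle : mollifiedEnergy s p ρ ε X ≤ mollifiedEnergy s p ρ ε (equispaced T)) :
    incrementEnergy T p (mollify ρ ε (equispaced T).displacement) =
      incrementEnergy T p (mollify ρ ε X.displacement) := by
  have hT := Nat.pos_of_neZero T
  have hc := fun Y : Configuration T =>
    continuous_incrementEnergy (T := T) (Y.contDiff_mollify hρ hε).continuous
      (by linarith : 0 ≤ p)
  obtain ⟨L, hL⟩ := (equispaced T).exists_lipschitzWith_mollify hT hρ hε
  have hfin : mollifiedEnergy s p ρ ε (equispaced T) ≠ ⊤ :=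
    gagliardoEnergy_ne_top hL ((equispaced T).periodic_mollify ρ ε) hT (by linarith) hs0 hs1
  rw [mollifiedEnergy_eq_lintegral _ hρ hε hp, mollifiedEnergy_eq_lintegral _ hρ hε hp] at hle
  rw [mollifiedEnergy_eq_lintegral _ hρ hε hp] at hfin
  have hae := ae_eq_of_ae_le_of_lintegral_le (Filter.Eventually.of_forall fun h =>
    ENNReal.ofReal_le_ofReal (div_le_div_of_nonneg_right
      (incrementEnergy_equispaced_le hρ hε hε1 hp hX h) (by positivity))) hfin
    (by
      have := (hc X).measurable
      fun_prop) hle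
  refine (Continuous.ae_eq_iff_eq volume (hc _) (hc _)).1 ?_
  filter_upwards [hae, compl_mem_ae_iff.2 (measure_singleton (0 : ℝ))] with h h1 h2
  have hpos : 0 < |h| := abs_pos.2 h2
  rw [ENNReal.ofReal_eq_ofReal_iff
    (div_nonneg (incrementEnergy_nonneg _ _ _ _) (by positivity))
    (div_nonneg (incrementEnergy_nonneg _ _ _ _) (by positivity))] at h1
  exact (div_left_inj' (by positivity)).1 h1

theorem isTranslate_of_mollifiedEnergy_le [NeZero T] (hρ : IsMollifier ρ) (hε : 0 < ε)
    (hε1 : 4 * ε ≤ 1) (hp : 1 < p) (hs0 : 0 < s) (hs1 : s < 1) {X : Configuration T}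
    (hX : X ∈ regular T (4 * ε))
    (hle : mollifiedEnergy s p ρ ε X ≤ mollifiedEnergy s p ρ ε (equispaced T)) :
    X.IsTranslate (equispaced T) := by
  have hT := Nat.pos_of_neZero T
  obtain ⟨G, hG⟩ := hρ.exists_smoothStep hε
  have h0p : (0 : ℝ) ^ p = 0 := Real.zero_rpow (by linarith)
  have h1 := (equispaced T).isSmoothDisplacement_mollify hρ hε
  rw [funext enum_equispaced] at h1
  -- With `h = n = 1` one has `θ = 0`, so the lattice value is `0` and each nonnegative cost
  -- `shiftCost (powerCost p 0) G (1 - (z_{i+1} - z_i))` must vanish.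
  have h2 := incrementEnergy_eq_of_intCast h1 hG hT hε.le hε1 hp 1 (n := 1) (by simp)
  have h3 := le_incrementEnergy (X.isSmoothDisplacement_mollify hρ hε) hG (periodicSeq_enum hX)
    (by linarith) hT hε.le hp 1 1
  rw [← incrementEnergy_eq_of_mollifiedEnergy_le hρ hε hε1 hp hs0 hs1 hX hle, h2] at h3
  have h4 : shiftCost (powerCost p 0) G 0 = 0 := by simp [shiftCost, powerCost]
  simp only [Int.cast_one, sub_self, abs_zero, h0p, h4, mul_zero, add_zero, zero_add] at h3
  have hnn : ∀ τ, 0 ≤ shiftCost (powerCost p 0) G τ := fun τ =>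
    integral_nonneg fun x => by simp only [powerCost, abs_zero, h0p, sub_zero]; positivity
  have h5 := (Finset.sum_eq_zero_iff_of_nonneg fun i _ => hnn _).1
    (h3.antisymm (Finset.sum_nonneg fun i _ => hnn _))
  have h6 : ∀ i : ℕ, i < T → X.enum i = X.enum 0 + i := by
    intro i
    induction i with
    | zero => simp
    | succ i ih =>
      intro hi
      have := hG.eq_zero_of_shiftCost_eq_zero hp (h5 i (Finset.mem_range.2 (by omega)))
      push_cast
      linarith [ih (by omega)]
  refine ⟨X.enum 0, Equiv.refl _, fun b => ?_⟩
  have h7 := X.enum_mul_add 0 b.1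
  have h8 := h6 b.1 b.1.2
  simp only [zero_mul, zero_add, Int.cast_zero, add_zero] at h7
  simp only [Equiv.refl_apply, point, equispaced]
  linarith

end Configuration

theorem mainTheorem4 (T : ℕ) (hT : 0 < T) (p s ε : ℝ) (hp : 1 ≤ p) (hs0 : 0 < s) (hs1 : s < 1)
    (hsp : 1 ≤ s * p) (hε : 0 < ε) (hε1 : 4 * ε ≤ 1) (ρ : ℝ → ℝ) (hρ : IsMollifier ρ) :
    Configuration.equispaced T ∈ Configuration.regular T (4 * ε) ∧
    IsMinOn (Configuration.mollifiedEnergy s p ρ ε) (Configuration.regular T (4 * ε))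
      (Configuration.equispaced T) ∧
    ∀ X ∈ Configuration.regular T (4 * ε),
      (IsMinOn (Configuration.mollifiedEnergy s p ρ ε) (Configuration.regular T (4 * ε)) X ↔
        X.IsTranslate (Configuration.equispaced T)) := by
  have : NeZero T := ⟨hT.ne'⟩
  -- Here `1 ≤ s * p` with `s < 1` excludes `p = 1`, so that `|·| ^ p` is continuously
  -- differentiable.
  have hp1 : 1 < p := by nlinarith
  have hreg := Configuration.equispaced_mem_regular (T := T) hε1
  have hmin := Configuration.isMinOn_equispaced (T := T) (s := s) hρ hε hε1 hp1
  refine ⟨hreg, hmin, fun X hX => ⟨fun h => ?_, fun h => isMinOn_iff.2 fun Y hY => ?_⟩⟩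
  · exact Configuration.isTranslate_of_mollifiedEnergy_le hρ hε hε1 hp1 hs0 hs1 hX
      (isMinOn_iff.1 h _ hreg)
  · rw [Configuration.mollifiedEnergy_eq_of_isTranslate hρ hε hp1 h]
    exact isMinOn_iff.1 hmin Y hY
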